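/- All rings are commutative with unity, and an extension ring $T$ of $R$ is a ring containing $R$ as a subring with the same unity. For $S\subseteq R$ let $P_S$ be the intersection of all minimal prime ideals of $R$ containing $S$ ($P_S=R$ if there are none), and $P_a=P_{\{a\}}$. A proper ideal $I$ of $R$ is a $z^\circ$-ideal if $P_a\subseteq I$ for each $a\in I$, and an $sz^\circ$-ideal if $P_S\subseteq I$ for each finite $S\subseteq I$. An ideal is nonregular if all its elements are zero divisors. An ideal $I$ is contracted from an extension ring $T$ if $I=J\cap R$ for some ideal $J$ of $T$; it is universally contracted if it is contracted from every extension ring of $R$, and universally proper if $IT\neq T$ for every extension ring $T$ of $R$. A simple ring extension of $R$ is an extension ring of the form $R[\alpha]$, and $I[\alpha]$ denotes the ideal $I\,R[\alpha]$. $I$ is countable strongly annihilated if for each countable $S\subseteq I$ and each $b\in R\setminus I$ there is $c\in R$ with $cs=0$ for all $s\in S$ and $cb\neq 0$. $I[x]$ and $I[[x]]$ are the ideals of polynomials, respectively power series, all of whose coefficients lie in $I$. $R$ satisfies the strong annihilator condition (s.a.c.) if every finitely generated ideal $I$ of $R$ contains an element $b$ with $\mathrm{Ann}(I)=\mathrm{Ann}(b)$.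 For a space $X$, $C(X)$ is the ring of continuous real-valued functions on $X$, and a maximal ideal $M$ of $C(X)$ is real if $C(X)/M\cong\mathbb R$. **Proposition.** (1) Let $R$ be a reduced ring with s.a.c. and let $M$ be a maximal ideal of $R$. The following conditions are equivalent. a) $M$ is universally contracted. b) $M$ is an $sz^\circ$-ideal. c) $M$ is a $z^\circ$-ideal. d) $M$ is nonregular. e) Each finite subset of $M$ is annihilated by a nonzero element of $R$. f) $M[\alpha]\neq R[\alpha]$ for each simple ring extension $R[\alpha]$ of $R$. g) $M$ is universally proper. h) $M$ is contracted from each simple ring extension of $R$. i) $M[x]$ is a universally contracted ideal of $R[x]$. j) $M[x]$ is an $sz^\circ$-ideal of $R[x]$. k) $M[x]$ is a $z^\circ$-ideal of $R[x]$. (2) Let $X$ be a completely regular Hausdorff space, $R=C(X)$, and let $M$ be a real maximal ideal of $C(X)$. Then a)–k) are equivalent to one another and to l) $M$ is countable strongly annihilated. (3) Let $X$ be a finite (completely regular) Hausdorff space, $R=C(X)$, and let $M$ be a maximal ideal of $C(X)$. Then a)–l) are equivalent to one another and to each of m) $M[[x]]$ is a countable strongly annihilated ideal of $R[[x]]$.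 n) $M[[x]]$ is a $z^\circ$-ideal of $R[[x]]$. -/

import Mathlib

universe u v w

section Ideals

variable {R : Type u} [CommRing R]

/-- The strong annihilator condition (s.a.c.): every finitely generated ideal `I` contains an
element `b` with `Ann(I) = Ann(b)`. -/
def StrongAnnihilatorCondition (R : Type u) [CommRing R] : Prop :=
  ∀ I : Ideal R, I.FG →
    ∃ b ∈ I, Submodule.annihilator I = Submodule.annihilator (Ideal.span {b})

/-- `P_S`: the intersection of all minimal prime ideals of `R` containing `S`
(it is `R` if there are none). -/
def minimalPrimeHull (S : Set R) : Ideal R :=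
  sInf {P : Ideal R | P ∈ minimalPrimes R ∧ S ⊆ (P : Set R)}

/-- `z°`-ideals: proper ideals `I` with `P_a ⊆ I` for all `a ∈ I`. -/
def IsZCircIdeal (I : Ideal R) : Prop :=
  I ≠ ⊤ ∧ ∀ a ∈ I, minimalPrimeHull {a} ≤ I

/-- `sz°`-ideals: proper ideals `I` with `P_S ⊆ I` for all finite `S ⊆ I`. -/
def IsSZCircIdeal (I : Ideal R) : Prop :=
  I ≠ ⊤ ∧ ∀ S : Set R, S.Finite → S ⊆ (I : Set R) → minimalPrimeHull S ≤ I

/-- An ideal is nonregular if it contains no regular element (non-zero-divisor). -/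
def IsNonregularIdeal (I : Ideal R) : Prop :=
  ∀ a ∈ I, a ∉ nonZeroDivisors R

/-- Each finite subset of `I` is annihilated by a nonzero element of `R`. -/
def FiniteSubsetsAnnihilated (I : Ideal R) : Prop :=
  ∀ S : Set R, S.Finite → S ⊆ (I : Set R) → ∃ c : R, c ≠ 0 ∧ ∀ a ∈ S, c * a = 0

/-- `I` is countable strongly annihilated: for each countable `S ⊆ I` and `b ∉ I` some `c`
annihilates `S` but not `b`. -/
def IsCountableStronglyAnnihilated (I : Ideal R) : Prop :=
  ∀ S : Set R, S.Countable → S ⊆ (I : Set R) → ∀ b : R, b ∉ I →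
    ∃ c : R, (∀ a ∈ S, c * a = 0) ∧ c * b ≠ 0

/-- `I` is contracted from the `R`-algebra `T`: `I = J ∩ R` for some ideal `J` of `T`. -/
def IsContractedFrom (I : Ideal R) (T : Type u) [CommRing T] [Algebra R T] : Prop :=
  ∃ J : Ideal T, J.comap (algebraMap R T) = I

/-- `T` is a simple ring extension `R[α]` of `R`. -/
def IsSimpleRingExtension (R T : Type u) [CommRing R] [CommRing T] [Algebra R T] : Prop :=
  Function.Injective (algebraMap R T) ∧ ∃ α : T, Algebra.adjoin R {α} = ⊤

/-- `I` is universally contracted: it is contracted from each extension ring of `R`. -/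
def IsUniversallyContracted (I : Ideal R) : Prop :=
  ∀ (T : Type u) [CommRing T] [Algebra R T], Function.Injective (algebraMap R T) →
    IsContractedFrom I T

/-- `I` is universally proper: `I T ≠ T` for each extension ring `T` of `R`. -/
def IsUniversallyProper (I : Ideal R) : Prop :=
  ∀ (T : Type u) [CommRing T] [Algebra R T], Function.Injective (algebraMap R T) →
    I.map (algebraMap R T) ≠ ⊤

/-- `I[α] ≠ R[α]` for each simple ring extension `R[α]` of `R`; the ideal `I[α]` of polynomial
expressions in `α` with coefficients in `I` is the extension of `I` to `R[α]`. -/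
def ProperInSimpleExtensions (I : Ideal R) : Prop :=
  ∀ (T : Type u) [CommRing T] [Algebra R T], IsSimpleRingExtension R T →
    I.map (algebraMap R T) ≠ ⊤

/-- `I` is contracted from each simple ring extension of `R`. -/
def IsContractedFromSimpleExtensions (I : Ideal R) : Prop :=
  ∀ (T : Type u) [CommRing T] [Algebra R T], IsSimpleRingExtension R T →
    IsContractedFrom I T

/-- `I[x]`, the ideal of polynomials with all coefficients in `I`
(see `Ideal.mem_map_C_iff`). -/
noncomputable def polyIdeal (I : Ideal R) : Ideal (Polynomial R) :=
  I.map (Polynomial.C : R →+* Polynomial R)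

/-- `I[[x]]`, the ideal of power series with all coefficients in `I`. -/
noncomputable def powerSeriesIdeal (I : Ideal R) : Ideal (PowerSeries R) where
  carrier := {f | ∀ n : ℕ, PowerSeries.coeff n f ∈ I}
  zero_mem' := fun n => by simp
  add_mem' := fun {f g} hf hg n => by
    rw [map_add]
    exact I.add_mem (hf n) (hg n)
  smul_mem' := fun c f hf n => by
    rw [smul_eq_mul, PowerSeries.coeff_mul]
    exact Ideal.sum_mem I fun p _ => I.mul_mem_left _ (hf p.2)

/-- The eleven conditions (a)-(k) on an ideal `M` of a ring `R`, in this order. -/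
def contractionConditions (M : Ideal R) : List Prop :=
  [ IsUniversallyContracted M,
    IsSZCircIdeal M,
    IsZCircIdeal M,
    IsNonregularIdeal M,
    FiniteSubsetsAnnihilated M,
    ProperInSimpleExtensions M,
    IsUniversallyProper M,
    IsContractedFromSimpleExtensions M,
    IsUniversallyContracted (polyIdeal M),
    IsSZCircIdeal (polyIdeal M),
    IsZCircIdeal (polyIdeal M) ]

end Ideals

/-- A maximal ideal `M` of `C(X)` is real if `C(X)/M` is isomorphic to `ℝ`. -/
def IsRealMaximalIdeal {X : Type u} [TopologicalSpace X] (M : Ideal C(X, ℝ)) : Prop :=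
  M.IsMaximal ∧ Nonempty ((C(X, ℝ) ⧸ M) ≃+* ℝ)

/-!
All conditions are compared with nonregularity of `M`.

If `M` contains a regular element `a`, every condition fails: `a` becomes a unit in the simple
extension `R[1/a]`, no minimal prime contains `a`, and `a` remains regular as a constant of `R[x]`
or `R[[x]]`.

Conversely, let `M` be nonregular. By s.a.c. a finite subset of `M` has the same annihilator as a
single element of `M`, so it is annihilated by some `c ≠ 0`. Since `M` is maximal, any `b ∉ M`
satisfies `1 = m + r b` with `m ∈ M`; adjoining `m` to the finite set makes `c = c r b`, so that
`c b ≠ 0`. Thus `M` is *strongly annihilated* (`IsStronglyAnnihilated`). This property passes to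
`M[x]` by looking at coefficients, and it implies directly that an ideal is universally contracted
and (over a reduced ring) an `sz°`-ideal, because `c` kills the finitely many elements of the ideal
that are involved, but not `b`.

For `C(X)`, a sum of squares is annihilated exactly by the functions annihilating each summand,
which gives s.a.c. If `M` is real, it is the kernel of a ring homomorphism `φ : C(X) → ℝ`, which is
automatically monotone and the identity on constants. Given `fₙ ∈ M`, the function
`g = ∑ 2⁻ⁿ fₙ² / (1 + fₙ²)` satisfies `0 ≤ φ g ≤ 2⁻ᴺ⁺¹` for all `N`, because its first `N`
terms lie in `M`; so `g ∈ M`, and whatever annihilates `g` annihilates all `fₙ`. The previous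
argument then works for countable sets. If `X` is finite, it is compact and every maximal ideal
of `C(X)` is the kernel of an evaluation, hence real; the claims on `R[[x]]` follow by looking at
coefficients, of which countably many power series have only countably many.
-/

/-! ### Strongly annihilated ideals -/

section StronglyAnnihilated

variable {R : Type u} [CommRing R]

/-- An ideal `I` is strongly annihilated if for each finite `S ⊆ I` and each `b ∉ I` some `c`
annihilates `S` but not `b`. -/
def IsStronglyAnnihilated (I : Ideal R) : Prop :=
  ∀ S : Set R, S.Finite → S ⊆ (I : Set R) → ∀ b : R, b ∉ I →
    ∃ c : R, (∀ a ∈ S, c * a = 0) ∧ c * b ≠ 0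

theorem IsCountableStronglyAnnihilated.isStronglyAnnihilated {I : Ideal R}
    (h : IsCountableStronglyAnnihilated I) : IsStronglyAnnihilated I :=
  fun S hS => h S hS.countable

/-- Only finitely many elements of `I` are involved in an element `t` of `I T`: whatever
annihilates them annihilates `t`. -/
theorem exists_finite_annihilating_of_mem_map {I : Ideal R} {T : Type v} [CommRing T]
    [Algebra R T] {t : T} (ht : t ∈ I.map (algebraMap R T)) :
    ∃ S : Set R, S.Finite ∧ S ⊆ (I : Set R) ∧
      ∀ c : R, (∀ a ∈ S, c * a = 0) → algebraMap R T c * t = 0 := by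
  induction ht using Submodule.span_induction with
  | mem x hx =>
    obtain ⟨a, ha, rfl⟩ := hx
    refine ⟨{a}, Set.finite_singleton a, Set.singleton_subset_iff.2 ha, fun c hc => ?_⟩
    rw [← map_mul, hc a rfl, map_zero]
  | zero => exact ⟨∅, Set.finite_empty, Set.empty_subset _, fun c _ => mul_zero _⟩
  | add x y _ _ hx hy =>
    obtain ⟨S, hS, hSI, hSx⟩ := hx
    obtain ⟨S', hS', hSI', hSy⟩ := hy
    refine ⟨S ∪ S', hS.union hS', Set.union_subset hSI hSI', fun c hc => ?_⟩
    rw [mul_add, hSx c fun a ha => hc a (Or.inl ha), hSy c fun a ha => hc a (Or.inr ha), add_zero]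
  | smul r x _ hx =>
    obtain ⟨S, hS, hSI, hSx⟩ := hx
    refine ⟨S, hS, hSI, fun c hc => ?_⟩
    rw [smul_eq_mul, mul_left_comm, hSx c hc, mul_zero]

theorem IsStronglyAnnihilated.isUniversallyContracted {I : Ideal R}
    (h : IsStronglyAnnihilated I) : IsUniversallyContracted I := by
  intro T _ _ hinj
  refine ⟨I.map (algebraMap R T), le_antisymm (fun b hb => ?_) Ideal.le_comap_map⟩
  by_contra hbI
  obtain ⟨S, hS, hSI, hSb⟩ := exists_finite_annihilating_of_mem_map hb
  obtain ⟨c, hc, hcb⟩ := h S hS hSI b hbI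
  exact hcb (hinj (by rw [map_mul, hSb c hc, map_zero]))

/-- If `c` annihilates `S`, then every minimal prime contains `S` or `c`, so that `c` annihilates
`P_S` in a reduced ring. -/
theorem mul_eq_zero_of_mem_minimalPrimeHull [IsReduced R] {S : Set R} {b c : R}
    (hb : b ∈ minimalPrimeHull S) (hc : ∀ a ∈ S, c * a = 0) : c * b = 0 := by
  have h : c * b ∈ sInf (minimalPrimes R) := by
    refine Submodule.mem_sInf.2 fun (P : Ideal R) hP => ?_
    have hPp : P.IsPrime := hP.1.1
    by_cases hcP : c ∈ P
    · exact P.mul_mem_right b hcP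
    · refine P.mul_mem_left c (Submodule.mem_sInf.1 hb P ⟨hP, fun a ha => ?_⟩)
      exact (hPp.mem_or_mem (by rw [hc a ha]; exact P.zero_mem)).resolve_left hcP
  rw [minimalPrimes, Ideal.sInf_minimalPrimes] at h
  exact ((mem_nilradical (R := R)).1 h).eq_zero

theorem IsStronglyAnnihilated.isSZCircIdeal [IsReduced R] {I : Ideal R}
    (h : IsStronglyAnnihilated I) (hI : I ≠ ⊤) : IsSZCircIdeal I := by
  refine ⟨hI, fun S hS hSI b hb => ?_⟩
  by_contra hbI
  obtain ⟨c, hc, hcb⟩ := h S hS hSI b hbI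
  exact hcb (mul_eq_zero_of_mem_minimalPrimeHull hb hc)

theorem IsSZCircIdeal.isZCircIdeal {I : Ideal R} (h : IsSZCircIdeal I) : IsZCircIdeal I :=
  ⟨h.1, fun a ha => h.2 {a} (Set.finite_singleton a) (Set.singleton_subset_iff.2 ha)⟩

/-- A regular element lies in no minimal prime, so `P_a = R` for regular `a`. -/
theorem IsZCircIdeal.isNonregularIdeal {I : Ideal R} (h : IsZCircIdeal I) :
    IsNonregularIdeal I := by
  intro a ha hreg
  refine h.1 ((Ideal.eq_top_iff_one I).2 (h.2 a ha (Submodule.mem_sInf.2 ?_)))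
  rintro P ⟨hP, haP⟩
  exact (Set.disjoint_left.1 (Ideal.disjoint_nonZeroDivisors_of_mem_minimalPrimes hP)
    (haP rfl) hreg).elim

/-- If an element of a maximal ideal `M` together with a set `S` is always annihilated by a common
nonzero element, then this element may be chosen not to annihilate a given `b ∉ M`: take the
element `m ∈ M` with `1 = m + r b`. -/
theorem exists_annihilating_of_notMem {M : Ideal R} (hM : M.IsMaximal) {S : Set R} {b : R}
    (hb : b ∉ M) (h : ∀ m ∈ M, ∃ c : R, c ≠ 0 ∧ ∀ a ∈ insert m S, c * a = 0) :
    ∃ c : R, (∀ a ∈ S, c * a = 0) ∧ c * b ≠ 0 := by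
  obtain ⟨r, m, hm, hrm⟩ := hM.exists_inv hb
  obtain ⟨c, hc0, hc⟩ := h m hm
  refine ⟨c, fun a ha => hc a (Or.inr ha), fun hcb => hc0 ?_⟩
  linear_combination (-c) * hrm + r * hcb + hc m (Set.mem_insert m S)

theorem FiniteSubsetsAnnihilated.isStronglyAnnihilated {M : Ideal R}
    (h : FiniteSubsetsAnnihilated M) (hM : M.IsMaximal) : IsStronglyAnnihilated M :=
  fun S hS hSM _ hb => exists_annihilating_of_notMem hM hb fun m hm =>
    h (insert m S) (hS.insert m) (Set.insert_subset hm hSM)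

theorem IsStronglyAnnihilated.isNonregularIdeal {I : Ideal R} (h : IsStronglyAnnihilated I)
    (hI : I ≠ ⊤) : IsNonregularIdeal I := by
  intro a ha hreg
  obtain ⟨c, hc, hc1⟩ := h {a} (Set.finite_singleton a) (Set.singleton_subset_iff.2 ha) 1
    fun h1 => hI ((Ideal.eq_top_iff_one I).2 h1)
  refine hc1 ?_
  rw [(mem_nonZeroDivisors_iff.1 hreg).2 c (hc a rfl), zero_mul]

theorem exists_ne_zero_mul_eq_zero_of_notMem_nonZeroDivisors {a : R}
    (ha : a ∉ nonZeroDivisors R) : ∃ c : R, c ≠ 0 ∧ c * a = 0 := by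
  by_contra! h
  exact ha (mem_nonZeroDivisors_iff_right.2 fun c hc => by_contra fun hc0 => h c hc0 hc)

theorem IsNonregularIdeal.finiteSubsetsAnnihilated (hR : StrongAnnihilatorCondition R)
    {I : Ideal R} (h : IsNonregularIdeal I) : FiniteSubsetsAnnihilated I := by
  intro S hS hSI
  obtain ⟨b, hb, hann⟩ := hR (Ideal.span S) ⟨hS.toFinset, by simp⟩
  obtain ⟨c, hc0, hc⟩ :=
    exists_ne_zero_mul_eq_zero_of_notMem_nonZeroDivisors (h b (Ideal.span_le.2 hSI hb))
  have hc' : c ∈ Submodule.annihilator (Ideal.span S) := by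
    rw [hann]
    exact (Submodule.mem_annihilator_span_singleton b c).2 hc
  exact ⟨c, hc0, fun a ha => Submodule.mem_annihilator.1 hc' a (Ideal.subset_span ha)⟩

end StronglyAnnihilated

/-! ### Extension rings -/

section Extensions

variable {R : Type u} [CommRing R]

theorem isSimpleRingExtension_localization_away {a : R} (ha : a ∈ nonZeroDivisors R) :
    IsSimpleRingExtension R (Localization.Away a) := by
  refine ⟨IsLocalization.injective _ (Submonoid.powers_le.2 ha),
    IsLocalization.Away.invSelf a, eq_top_iff.2 fun z _ => ?_⟩
  set t : Localization.Away a := IsLocalization.Away.invSelf a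
  obtain ⟨n, r, hr⟩ := IsLocalization.Away.surj a z
  have h1 : algebraMap R (Localization.Away a) a * t = 1 := IsLocalization.Away.mul_invSelf a
  have hz : z = algebraMap R (Localization.Away a) r * t ^ n := by
    rw [← hr, mul_assoc, ← mul_pow, h1, one_pow, mul_one]
  rw [hz]
  exact mul_mem (Subalgebra.algebraMap_mem _ r)
    (pow_mem (Algebra.subset_adjoin (Set.mem_singleton t)) n)

/-- An element `a` of `I` is a unit of `R[1/a]`, where `I` therefore extends to the unit
ideal. -/
theorem map_localization_away_eq_top {I : Ideal R} {a : R} (ha : a ∈ I) :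
    I.map (algebraMap R (Localization.Away a)) = ⊤ :=
  Ideal.eq_top_of_isUnit_mem _ (Ideal.mem_map_of_mem _ ha)
    (IsLocalization.Away.algebraMap_isUnit a)

theorem ProperInSimpleExtensions.isNonregularIdeal {I : Ideal R}
    (h : ProperInSimpleExtensions I) : IsNonregularIdeal I :=
  fun a ha hreg => h (Localization.Away a) (isSimpleRingExtension_localization_away hreg)
    (map_localization_away_eq_top ha)

theorem IsContractedFrom.map_ne_top {I : Ideal R} {T : Type u} [CommRing T] [Algebra R T]
    (h : IsContractedFrom I T) (hI : I ≠ ⊤) : I.map (algebraMap R T) ≠ ⊤ := by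
  obtain ⟨J, hJ⟩ := h
  intro htop
  have hJtop : J = ⊤ := top_le_iff.1 (htop ▸ Ideal.map_le_iff_le_comap.2 hJ.ge)
  exact hI (by rw [← hJ, hJtop, Ideal.comap_top])

theorem IsUniversallyContracted.isUniversallyProper {I : Ideal R}
    (h : IsUniversallyContracted I) (hI : I ≠ ⊤) : IsUniversallyProper I :=
  fun T _ _ hinj => (h T hinj).map_ne_top hI

theorem IsUniversallyProper.properInSimpleExtensions {I : Ideal R}
    (h : IsUniversallyProper I) : ProperInSimpleExtensions I :=
  fun T _ _ hT => h T hT.1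

theorem IsUniversallyContracted.isContractedFromSimpleExtensions {I : Ideal R}
    (h : IsUniversallyContracted I) : IsContractedFromSimpleExtensions I :=
  fun T _ _ hT => h T hT.1

theorem IsContractedFromSimpleExtensions.properInSimpleExtensions {I : Ideal R}
    (h : IsContractedFromSimpleExtensions I) (hI : I ≠ ⊤) : ProperInSimpleExtensions I :=
  fun T _ _ hT => (h T hT).map_ne_top hI

end Extensions

/-! ### Polynomials and power series -/

section Coefficients

variable {R : Type u} [CommRing R]

theorem mem_polyIdeal_iff {I : Ideal R} {f : Polynomial R} :
    f ∈ polyIdeal I ↔ ∀ n, f.coeff n ∈ I :=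
  Ideal.mem_map_C_iff

theorem mem_powerSeriesIdeal_iff {I : Ideal R} {f : PowerSeries R} :
    f ∈ powerSeriesIdeal I ↔ ∀ n, PowerSeries.coeff n f ∈ I :=
  Iff.rfl

theorem polyIdeal_ne_top {I : Ideal R} (hI : I ≠ ⊤) : polyIdeal I ≠ ⊤ := by
  rw [Ideal.ne_top_iff_one] at hI ⊢
  exact fun h => hI (by simpa using mem_polyIdeal_iff.1 h 0)

theorem powerSeriesIdeal_ne_top {I : Ideal R} (hI : I ≠ ⊤) : powerSeriesIdeal I ≠ ⊤ := by
  rw [Ideal.ne_top_iff_one] at hI ⊢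
  exact fun h => hI (by simpa using mem_powerSeriesIdeal_iff.1 h 0)

theorem IsNonregularIdeal.of_polyIdeal {I : Ideal R} (h : IsNonregularIdeal (polyIdeal I)) :
    IsNonregularIdeal I := by
  intro a ha hreg
  refine h (Polynomial.C a) (Ideal.mem_map_of_mem _ ha)
    (mem_nonZeroDivisors_iff_right.2 fun f hf => Polynomial.ext fun n => ?_)
  refine (mem_nonZeroDivisors_iff_right.1 hreg) _ ?_
  rw [← Polynomial.coeff_mul_C, hf, Polynomial.coeff_zero]

theorem IsNonregularIdeal.of_powerSeriesIdeal {I : Ideal R}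
    (h : IsNonregularIdeal (powerSeriesIdeal I)) : IsNonregularIdeal I := by
  intro a ha hreg
  refine h (PowerSeries.C a) (mem_powerSeriesIdeal_iff.2 fun n => ?_)
    (mem_nonZeroDivisors_iff_right.2 fun f hf => PowerSeries.ext fun n => ?_)
  · rw [PowerSeries.coeff_C]
    split_ifs
    exacts [ha, I.zero_mem]
  · refine (mem_nonZeroDivisors_iff_right.1 hreg) _ ?_
    rw [← PowerSeries.coeff_mul_C, hf, map_zero]

theorem IsStronglyAnnihilated.polyIdeal {I : Ideal R} (h : IsStronglyAnnihilated I) :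
    IsStronglyAnnihilated (polyIdeal I) := by
  intro S hS hSI b hb
  obtain ⟨n, hn⟩ := not_forall.1 (mt mem_polyIdeal_iff.2 hb)
  obtain ⟨c, hc, hcb⟩ := h (⋃ f ∈ S, (f.coeffs : Set R))
    (hS.biUnion fun f _ => f.coeffs.finite_toSet)
    (Set.iUnion₂_subset fun f hf r hr => by
      obtain ⟨k, -, rfl⟩ := Polynomial.mem_coeffs_iff.1 hr
      exact mem_polyIdeal_iff.1 (hSI hf) k) _ hn
  refine ⟨Polynomial.C c, fun f hf => Polynomial.ext fun k => ?_, fun h0 => hcb ?_⟩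
  · rw [Polynomial.coeff_C_mul, Polynomial.coeff_zero]
    by_cases hk : f.coeff k = 0
    · rw [hk, mul_zero]
    · exact hc _ (Set.mem_biUnion hf (Polynomial.coeff_mem_coeffs hk))
  · rw [← Polynomial.coeff_C_mul, h0, Polynomial.coeff_zero]

theorem IsCountableStronglyAnnihilated.powerSeriesIdeal {I : Ideal R}
    (h : IsCountableStronglyAnnihilated I) :
    IsCountableStronglyAnnihilated (powerSeriesIdeal I) := by
  intro S hS hSI b hb
  obtain ⟨n, hn⟩ := not_forall.1 (mt mem_powerSeriesIdeal_iff.2 hb)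
  obtain ⟨c, hc, hcb⟩ := h (⋃ f ∈ S, Set.range fun k => PowerSeries.coeff k f)
    (hS.biUnion fun f _ => Set.countable_range _)
    (Set.iUnion₂_subset fun f hf => by
      rintro _ ⟨k, rfl⟩
      exact mem_powerSeriesIdeal_iff.1 (hSI hf) k) _ hn
  refine ⟨PowerSeries.C c, fun f hf => PowerSeries.ext fun k => ?_, fun h0 => hcb ?_⟩
  · rw [PowerSeries.coeff_C_mul, map_zero]
    exact hc _ (Set.mem_biUnion hf ⟨k, rfl⟩)
  · rw [← PowerSeries.coeff_C_mul, h0, map_zero]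

theorem isReduced_powerSeries [IsReduced R] : IsReduced (PowerSeries R) := by
  refine (isReduced_iff_pow_one_lt 2 one_lt_two).2 fun f hf => PowerSeries.ext fun n => ?_
  induction n using Nat.strong_induction_on with
  | _ n ih =>
    -- All other terms of the coefficient of degree `2 n` of `f ^ 2` involve lower coefficients.
    have h2 : PowerSeries.coeff (n + n) (f ^ 2) =
        PowerSeries.coeff n f * PowerSeries.coeff n f := by
      rw [sq, PowerSeries.coeff_mul]
      refine Finset.sum_eq_single (n, n) (fun p hp hne => ?_) fun h => ?_
      · rw [Finset.HasAntidiagonal.mem_antidiagonal] at hp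
        rcases lt_trichotomy p.1 n with h | h | h
        · rw [ih _ h, map_zero, zero_mul]
        · exact (hne (Prod.ext h (by dsimp only; omega))).elim
        · rw [ih p.2 (by omega), map_zero, mul_zero]
      · exact (h (Finset.HasAntidiagonal.mem_antidiagonal.2 rfl)).elim
    rw [hf, map_zero] at h2
    rw [map_zero]
    exact IsReduced.eq_zero _ ⟨2, by rw [sq, ← h2]⟩

theorem isReduced_polynomial [IsReduced R] : IsReduced (Polynomial R) :=
  have := isReduced_powerSeries (R := R)
  isReduced_of_injective (Polynomial.coeToPowerSeries.ringHom (R := R))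
    (Polynomial.coe_injective R)

end Coefficients

/-! ### Conditions equivalent to nonregularity -/

theorem List.tfae_of_forall_iff {l : List Prop} {p : Prop} (h : ∀ q ∈ l, (q ↔ p)) : l.TFAE :=
  fun q hq r hr => (h q hq).trans (h r hr).symm

theorem contractionConditions_iff_isNonregularIdeal {R : Type u} [CommRing R] [IsReduced R]
    (hR : StrongAnnihilatorCondition R) {M : Ideal R} (hM : M.IsMaximal) :
    ∀ q ∈ contractionConditions M, (q ↔ IsNonregularIdeal M) := by
  have hne : M ≠ ⊤ := hM.ne_top
  have := isReduced_polynomial (R := R)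
  have hfin : IsNonregularIdeal M → FiniteSubsetsAnnihilated M := fun h =>
    h.finiteSubsetsAnnihilated hR
  have hsa : IsNonregularIdeal M → IsStronglyAnnihilated M := fun h =>
    (hfin h).isStronglyAnnihilated hM
  have huc : IsNonregularIdeal M → IsUniversallyContracted M := fun h =>
    (hsa h).isUniversallyContracted
  have hsz : IsNonregularIdeal M → IsSZCircIdeal M := fun h => (hsa h).isSZCircIdeal hne
  have hszx : IsNonregularIdeal M → IsSZCircIdeal (polyIdeal M) := fun h =>
    (hsa h).polyIdeal.isSZCircIdeal (polyIdeal_ne_top hne)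
  simp only [contractionConditions, List.forall_mem_cons, List.not_mem_nil, false_imp_iff,
    implies_true, and_true, true_and]
  exact ⟨
    ⟨fun h => (h.isUniversallyProper hne).properInSimpleExtensions.isNonregularIdeal, huc⟩,
    ⟨fun h => h.isZCircIdeal.isNonregularIdeal, hsz⟩,
    ⟨fun h => h.isNonregularIdeal, fun h => (hsz h).isZCircIdeal⟩,
    ⟨fun h => (h.isStronglyAnnihilated hM).isNonregularIdeal hne, hfin⟩,
    ⟨fun h => h.isNonregularIdeal,
      fun h => ((huc h).isUniversallyProper hne).properInSimpleExtensions⟩,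
    ⟨fun h => h.properInSimpleExtensions.isNonregularIdeal,
      fun h => (huc h).isUniversallyProper hne⟩,
    ⟨fun h => (h.properInSimpleExtensions hne).isNonregularIdeal,
      fun h => (huc h).isContractedFromSimpleExtensions⟩,
    ⟨fun h => (h.isUniversallyProper
        (polyIdeal_ne_top hne)).properInSimpleExtensions.isNonregularIdeal.of_polyIdeal,
      fun h => (hsa h).polyIdeal.isUniversallyContracted⟩,
    ⟨fun h => h.isZCircIdeal.isNonregularIdeal.of_polyIdeal, hszx⟩,
    ⟨fun h => h.isNonregularIdeal.of_polyIdeal, fun h => (hszx h).isZCircIdeal⟩⟩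

/-! ### Rings of continuous functions -/

section ContinuousFunctions

variable {X : Type w} [TopologicalSpace X]

theorem isReduced_continuousMap : IsReduced C(X, ℝ) := by
  refine (isReduced_iff_pow_one_lt 2 one_lt_two).2 fun f hf => ContinuousMap.ext fun x => ?_
  have h : (f x) ^ 2 = 0 := by simpa using DFunLike.congr_fun hf x
  simpa using h

/-- For generators `s` of an ideal of `C(X)`, the element `∑ s ^ 2` has the same annihilator as the
ideal. -/
theorem strongAnnihilatorCondition_continuousMap : StrongAnnihilatorCondition C(X, ℝ) := by
  rintro I ⟨s, rfl⟩
  have hmem : ∑ f ∈ s, f ^ 2 ∈ Ideal.span (s : Set C(X, ℝ)) :=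
    Ideal.sum_mem _ fun f hf => Ideal.pow_mem_of_mem _ (Ideal.subset_span hf) 2 two_pos
  refine ⟨∑ f ∈ s, f ^ 2, hmem, le_antisymm
    (Submodule.annihilator_mono ((Ideal.span_singleton_le_iff_mem _).2 hmem)) fun c hc => ?_⟩
  rw [Submodule.mem_annihilator_span_singleton, smul_eq_mul] at hc
  refine (Submodule.mem_annihilator_span _ c).2 fun ⟨f, hf⟩ => ContinuousMap.ext fun x => ?_
  have hx : c x * ∑ g ∈ s, g x ^ 2 = 0 := by
    simpa [ContinuousMap.sum_apply] using DFunLike.congr_fun hc x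
  rcases mul_eq_zero.1 hx with h | h
  · simp [h]
  · have hfx : f x ^ 2 = 0 :=
      (Finset.sum_eq_zero_iff_of_nonneg fun g _ => sq_nonneg (g x)).1 h f hf
    have hfx' : f x = 0 := by simpa using hfx
    simp [hfx']

theorem ringHom_continuousMap_const (φ : C(X, ℝ) →+* ℝ) (r : ℝ) :
    φ (ContinuousMap.const X r) = r :=
  -- The identity is the only ring endomorphism of `ℝ`.
  DFunLike.congr_fun
    (Subsingleton.elim (φ.comp (algebraMap ℝ C(X, ℝ))) (RingHom.id ℝ)) r

/-- Nonnegative functions are squares, so ring homomorphisms preserve nonnegativity. -/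
theorem ringHom_continuousMap_nonneg (φ : C(X, ℝ) →+* ℝ) {f : C(X, ℝ)} (hf : ∀ x, 0 ≤ f x) :
    0 ≤ φ f := by
  have h : f = (⟨fun x => √(f x), by fun_prop⟩ : C(X, ℝ)) ^ 2 :=
    ContinuousMap.ext fun x => (Real.sq_sqrt (hf x)).symm
  rw [h, map_pow]
  exact sq_nonneg _

/-- The kernel of a ring homomorphism `C(X) → ℝ` contains, with any sequence of functions, a
function whose zeros are common zeros of the sequence. -/
theorem exists_mem_ker_forall_zero (φ : C(X, ℝ) →+* ℝ) (f : ℕ → C(X, ℝ))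
    (hf : ∀ n, φ (f n) = 0) : ∃ g, φ g = 0 ∧ ∀ x, g x = 0 → ∀ n, f n x = 0 := by
  have hden : ∀ n x, 1 + f n x ^ 2 ≠ 0 := fun n x => by positivity
  let q : ℕ → C(X, ℝ) := fun n => ⟨fun x => (1 + f n x ^ 2)⁻¹,
    Continuous.inv₀ (by fun_prop) (hden n)⟩
  let h : ℕ → C(X, ℝ) := fun n => ContinuousMap.const X ((1 / 2 : ℝ) ^ n) * (f n ^ 2 * q n)
  have hh : ∀ n x, h n x = (1 / 2) ^ n * (f n x ^ 2 * (1 + f n x ^ 2)⁻¹) := fun n x => rfl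
  have hφh : ∀ n, φ (h n) = 0 := fun n => by
    simp only [h, map_mul, map_pow, hf n]
    ring
  have hnn : ∀ n x, 0 ≤ h n x := fun n x => by rw [hh]; positivity
  have hle : ∀ n x, h n x ≤ (1 / 2) ^ n := fun n x => by
    rw [hh]
    refine mul_le_of_le_one_right (by positivity) ?_
    rw [← div_eq_mul_inv]
    exact div_le_one_of_le₀ (by linarith) (by positivity)
  have hsum : Summable fun n : ℕ => (1 / 2 : ℝ) ^ n := summable_geometric_two
  have hsumx : ∀ x, Summable fun n => h n x := fun x =>
    Summable.of_nonneg_of_le (fun n => hnn n x) (fun n => hle n x) hsum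
  let g : C(X, ℝ) := ⟨fun x => ∑' n, h n x, continuous_tsum (fun n => (h n).continuous) hsum
    fun n x => by rw [Real.norm_of_nonneg (hnn n x)]; exact hle n x⟩
  have hg : ∀ x, g x = ∑' n, h n x := fun x => rfl
  have hbound : ∀ N : ℕ, φ g ≤ 2 * (1 / 2) ^ N := fun N => by
    have hnonneg := ringHom_continuousMap_nonneg φ
      (f := ∑ n ∈ Finset.range N, h n + ContinuousMap.const X (2 * (1 / 2) ^ N) - g) fun x => by
        have htail : ∑' n, h (n + N) x ≤ 2 * (1 / 2) ^ N := by
          calc ∑' n, h (n + N) x ≤ ∑' n : ℕ, (1 / 2 : ℝ) ^ n * (1 / 2) ^ N :=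
                Summable.tsum_le_tsum (fun n => by rw [← pow_add]; exact hle (n + N) x)
                  ((summable_nat_add_iff N).2 (hsumx x)) (hsum.mul_right _)
            _ = 2 * (1 / 2) ^ N := by rw [tsum_mul_right, tsum_geometric_two]
        have hsplit := (hsumx x).sum_add_tsum_nat_add N
        simp only [ContinuousMap.sub_apply, ContinuousMap.add_apply, ContinuousMap.sum_apply,
          ContinuousMap.const_apply, hg]
        linarith
    rw [map_sub, map_add, map_sum, Finset.sum_eq_zero fun n _ => hφh n,
      ringHom_continuousMap_const] at hnonneg
    linarith
  refine ⟨g, le_antisymm ?_ (ringHom_continuousMap_nonneg φ fun x => tsum_nonneg fun n => hnn n x),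
    fun x hx n => ?_⟩
  · have hlim : Filter.Tendsto (fun N : ℕ => 2 * (1 / 2 : ℝ) ^ N) Filter.atTop (nhds (2 * 0)) :=
      (tendsto_pow_atTop_nhds_zero_of_lt_one (by norm_num) (by norm_num)).const_mul 2
    rw [mul_zero] at hlim
    exact ge_of_tendsto' hlim hbound
  · have h0 : h n x = 0 :=
      congrFun ((hasSum_zero_iff_of_nonneg fun n => hnn n x).1
        (by rw [← hx]; exact (hsumx x).hasSum)) n
    rw [hh] at h0
    have h1 : (1 / 2 : ℝ) ^ n ≠ 0 := by positivity
    simpa [h1, hden n x] using h0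

theorem IsRealMaximalIdeal.exists_ringHom {M : Ideal C(X, ℝ)} (hM : IsRealMaximalIdeal M) :
    ∃ φ : C(X, ℝ) →+* ℝ, ∀ f, φ f = 0 ↔ f ∈ M := by
  obtain ⟨-, ⟨e⟩⟩ := hM
  refine ⟨(e : _ →+* ℝ).comp (Ideal.Quotient.mk M), fun f => ?_⟩
  rw [RingHom.comp_apply, RingHom.coe_coe, EmbeddingLike.map_eq_zero_iff,
    Ideal.Quotient.eq_zero_iff_mem]

theorem IsRealMaximalIdeal.isCountableStronglyAnnihilated {M : Ideal C(X, ℝ)}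
    (hM : IsRealMaximalIdeal M) (h : IsNonregularIdeal M) :
    IsCountableStronglyAnnihilated M := by
  intro S hS hSM b hb
  obtain ⟨φ, hφ⟩ := hM.exists_ringHom
  refine exists_annihilating_of_notMem hM.1 hb fun m hm => ?_
  obtain ⟨f, hf⟩ := (hS.insert m).exists_eq_range (Set.insert_nonempty m S)
  have hfM : ∀ n, f n ∈ M := fun n =>
    Set.insert_subset hm hSM (hf ▸ Set.mem_range_self n)
  obtain ⟨g, hg, hgf⟩ := exists_mem_ker_forall_zero φ f fun n => (hφ _).2 (hfM n)
  obtain ⟨c, hc0, hc⟩ :=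
    exists_ne_zero_mul_eq_zero_of_notMem_nonZeroDivisors (h g ((hφ g).1 hg))
  refine ⟨c, hc0, ?_⟩
  rw [hf, Set.forall_mem_range]
  refine fun n => ContinuousMap.ext fun x => ?_
  have hx : c x * g x = 0 := DFunLike.congr_fun hc x
  rcases mul_eq_zero.1 hx with h | h
  · simp [h]
  · simp [hgf x h n]

theorem IsRealMaximalIdeal.isCountableStronglyAnnihilated_iff {M : Ideal C(X, ℝ)}
    (hM : IsRealMaximalIdeal M) :
    IsCountableStronglyAnnihilated M ↔ IsNonregularIdeal M :=
  ⟨fun h => h.isStronglyAnnihilated.isNonregularIdeal hM.1.ne_top,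
    hM.isCountableStronglyAnnihilated⟩

/-- In a compact Hausdorff space each maximal ideal is the kernel of evaluation at a point. -/
theorem isRealMaximalIdeal_of_isMaximal [CompactSpace X] [T2Space X] {M : Ideal C(X, ℝ)}
    (hM : M.IsMaximal) : IsRealMaximalIdeal M := by
  have : IsClosed (M : Set C(X, ℝ)) := hM.isClosed
  obtain ⟨x, hx⟩ := (ContinuousMap.ideal_isMaximal_iff M).1 hM
  let ev : C(X, ℝ) →+* ℝ := (ContinuousMap.evalAlgHom ℝ ℝ x : C(X, ℝ) →ₐ[ℝ] ℝ)
  have hev : RingHom.ker ev = M := by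
    rw [← hx]
    ext f
    exact (ContinuousMap.mem_idealOfSet_compl_singleton x f).symm
  refine ⟨hM, ⟨(Ideal.quotEquivOfEq hev.symm).trans
    (RingHom.quotientKerEquivOfSurjective (f := ev) fun r => ⟨ContinuousMap.const X r, rfl⟩)⟩⟩

end ContinuousFunctions

theorem mainTheorem10 :
    (∀ (R : Type v) [CommRing R] [IsReduced R], StrongAnnihilatorCondition R →
      ∀ M : Ideal R, M.IsMaximal → (contractionConditions M).TFAE) ∧
    (∀ (X : Type w) [TopologicalSpace X] [T35Space X] (M : Ideal C(X, ℝ)),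
      IsRealMaximalIdeal M →
        (contractionConditions M ++ [IsCountableStronglyAnnihilated M]).TFAE) ∧
    (∀ (X : Type w) [TopologicalSpace X] [T35Space X] [Finite X] (M : Ideal C(X, ℝ)),
      M.IsMaximal →
        (contractionConditions M ++
          [ IsCountableStronglyAnnihilated M,
            IsCountableStronglyAnnihilated (powerSeriesIdeal M),
            IsZCircIdeal (powerSeriesIdeal M) ]).TFAE) := by
  refine ⟨fun R _ _ hR M hM =>
      List.tfae_of_forall_iff (contractionConditions_iff_isNonregularIdeal hR hM),
    fun X _ _ M hM => ?_, fun X _ _ _ M hM => ?_⟩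
  · have := isReduced_continuousMap (X := X)
    refine List.tfae_of_forall_iff (List.forall_mem_append.2
      ⟨contractionConditions_iff_isNonregularIdeal strongAnnihilatorCondition_continuousMap hM.1,
        List.forall_mem_singleton.2 hM.isCountableStronglyAnnihilated_iff⟩)
  · have := isReduced_continuousMap (X := X)
    have := isReduced_powerSeries (R := C(X, ℝ))
    have hreal := isRealMaximalIdeal_of_isMaximal hM
    have hne := powerSeriesIdeal_ne_top hM.ne_top
    have hm : IsNonregularIdeal M → IsCountableStronglyAnnihilated (powerSeriesIdeal M) :=
      fun h => (hreal.isCountableStronglyAnnihilated h).powerSeriesIdeal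
    refine List.tfae_of_forall_iff (List.forall_mem_append.2
      ⟨contractionConditions_iff_isNonregularIdeal strongAnnihilatorCondition_continuousMap hM, ?_⟩)
    simp only [List.forall_mem_cons, List.not_mem_nil, false_imp_iff, implies_true, and_true]
    exact ⟨hreal.isCountableStronglyAnnihilated_iff,
      ⟨fun h => (h.isStronglyAnnihilated.isNonregularIdeal hne).of_powerSeriesIdeal, hm⟩,
      ⟨fun h => h.isNonregularIdeal.of_powerSeriesIdeal,
        fun h => ((hm h).isStronglyAnnihilated.isSZCircIdeal hne).isZCircIdeal⟩⟩
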